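/- For an integer $k\ge 0$, the game $\mathrm{CHSH}+k$ is played by $k+2$ players, Alice, Bob and Charlie$_1,\dots,$Charlie$_k$, who cannot communicate. With probability $q=1-\frac{2}{3^k+1}$ the verifier asks a consistency question: she picks $J\in\{1,\dots,k\}$ uniformly at random, sends the bit $A=0$ to Alice and $C_J=0$ to Charlie$_J$ (and nothing to the others), and accepts if their answer bits satisfy $X=Z_J$. With probability $1-q$ she asks a game question: she sends independent uniformly random bits $A$ to Alice and $B$ to Bob; if $A=0$, nothing is sent to the Charlies and she accepts if $X=Y$; if $A=1$, she also sends $C_j=1$ to every Charlie$_j$ and accepts if $X\oplus Z_1\oplus\dots\oplus Z_k\oplus Y=B$. (Here $X,Y,Z_j$ are the answer bits of Alice, Bob and Charlie$_j$.) Let $\omega_q(\mathrm{CHSH}+k)$ be the quantum value, the supremum of the winning probabilities of players who perform local measurements on a shared finite-dimensional quantum state. Theorem. Let $k\ge 0$. Classical players who share randomness and any finite number of arbitrary (possibly multi-round, adaptively used) non-signaling resources, each of which involves at most $k+1$ of the players, win $\mathrm{CHSH}+k$ with probability at most $1-\frac{1}{2(3^k+1)}$. Moreover $$1-\frac{1}{2(3^k+1)}<\omega_q(\mathrm{CHSH}+k),\qquad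 \omega_q(\mathrm{CHSH}+k)-\Big(1-\frac{1}{2(3^k+1)}\Big)\ge\frac{\sqrt2-1}{2(3^k+1)},$$ and players who share the $(k+2)$-qubit GHZ state $\frac{1}{\sqrt2}(|0^{k+2}\rangle+|1^{k+2}\rangle)$ have local measurements that win with probability exactly $1-(1-q)\sin^2\frac{\pi}{8}$, which already exceeds $1-\frac{1}{2(3^k+1)}$ by at least $\frac{\sqrt2-1}{2(3^k+1)}$. -/

import Mathlib

open scoped ENNReal ComplexOrder
open MeasureTheory

universe u

/-! ## Non-signaling resources -/

/-- A (multi-round) non-signaling resource shared by a finite set `parties` of the players `P`.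
Party `p` may feed it inputs from `In p` one after the other, at times of its own choosing, and
after each input receives an output in `Out p`.

A tuple `t` of transcripts lists, for every party, its inputs and outputs so far in chronological
order, and `prob t` is the conditional probability `Pr[outputs listed in t | inputs listed in t]`.
The transcripts of different parties may have different lengths.

The field `nonsignaling` says that one further input `a` of one party `p` does not change the
joint distribution of anything else: the marginal distribution, when the new output of `p` is
summed over, is the one without the new input, whatever `a` is. This is both causality
(outputs do not depend on later inputs) and the non-signaling condition. A usual one-round
non-signaling box is the case in which only the first input of each party matters. -/
structure NSResource (P : Type) [DecidableEq P] where
  parties : Finset P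
  In : P → Type u
  Out : P → Type u
  prob : (∀ p : parties, List (In p × Out p)) → ℝ≥0∞
  prob_nil : prob (fun _ => []) = 1
  nonsignaling : ∀ (t : ∀ p : parties, List (In p × Out p)) (p : parties) (a : In p),
    ∑' x : Out p, prob (Function.update t p (t p ++ [(a, x)])) = prob t

/-! ## Classical players with access to non-signaling resources -/

/-- An adaptive deterministic program of player `p`: either answer a bit, or feed an input `a` to
a resource `R i` in which `p` takes part and continue depending on the output. -/
inductive Program {P : Type} [DecidableEq P] {m : ℕ} (R : Fin m → NSResource.{u} P) (p : P) :
    Type u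
  | answer (b : Bool) : Program R p
  | query (i : Fin m) (hp : p ∈ (R i).parties) (a : (R i).In p)
      (next : (R i).Out p → Program R p) : Program R p

namespace Program

variable {P : Type} [DecidableEq P] {m : ℕ} {R : Fin m → NSResource.{u} P} {p : P}

/-- A complete run of a program: the sequence of outputs that the resources give to `p`. -/
def Run : Program R p → Type u
  | answer _ => PUnit
  | query i _ _ next => Σ x : (R i).Out p, Run (next x)

/-- The bit that the player answers at the end of a run. -/
def result : (T : Program R p) → T.Run → Bool
  | answer b, _ => b
  | query _ _ _ next, ⟨x, r⟩ => (next x).result r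

/-- The transcript, in chronological order, of the player's interaction with each resource. -/
def transcript : (T : Program R p) → T.Run → ∀ i : Fin m, List ((R i).In p × (R i).Out p)
  | answer _, _ => fun _ => []
  | query i _ a next, ⟨x, r⟩ =>
      Function.update ((next x).transcript r) i ((a, x) :: (next x).transcript r i)

end Program

/-- The probability of a tuple of runs, one of each player: the resources are independent of each
other, so it is the product over the resources of the probability of the respective outputs given
the respective inputs. -/
noncomputable def runProb {P : Type} [DecidableEq P] {m : ℕ} {R : Fin m → NSResource.{u} P}
    (T : ∀ p, Program R p) (r : ∀ p, (T p).Run) : ℝ≥0∞ :=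
  ∏ i : Fin m, (R i).prob (fun p => (T p).transcript (r p) i)

open Classical in
/-- The probability that the players, running the programs `T`, answer with the bits `x`. -/
noncomputable def answerProb {P : Type} [DecidableEq P] {m : ℕ} {R : Fin m → NSResource.{u} P}
    (T : ∀ p, Program R p) (x : P → Bool) : ℝ≥0∞ :=
  ∑' r : ∀ p, (T p).Run, if (fun p => (T p).result (r p)) = x then runProb T r else 0

/-- A strategy of classical players that cannot communicate, but share randomness (a point `ω` of
a probability space) and a finite number of non-signaling resources, each of which involves
at most `n` players. Each player receives a bit (`some a`) from the verifier or is left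
without a question (`none`), and then runs a program that depends on this input and on the
shared randomness. (Private randomness may be made part of the shared randomness.) -/
structure NSStrategy (P : Type) [DecidableEq P] (n : ℕ) where
  numResources : ℕ
  resource : Fin numResources → NSResource.{u} P
  card_parties_le : ∀ i, (resource i).parties.card ≤ n
  Ω : Type u
  mΩ : MeasurableSpace Ω
  μ : Measure Ω
  isProbabilityMeasure : IsProbabilityMeasure μ
  program : Ω → ∀ p, Option Bool → Program resource p
  measurable_answerProb : ∀ (a : P → Option Bool) (x : P → Bool),
    Measurable fun ω => answerProb (fun p => program ω p (a p)) x

/-- A correlation: the conditional probabilities `Pr[X = x | A = a]` of the players' answers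
given the verifier's inputs. -/
abbrev Correlation (P : Type) : Type := (P → Option Bool) → (P → Bool) → ℝ

/-- The correlation that a classical strategy with non-signaling resources generates. -/
noncomputable def NSStrategy.correlation {P : Type} [DecidableEq P] {n : ℕ}
    (S : NSStrategy.{u} P n) : Correlation P := fun a x =>
  letI := S.mΩ
  (∫⁻ ω, answerProb (fun p => S.program ω p (a p)) x ∂S.μ).toReal

/-! ## Quantum strategies -/

/-- Measurements of players with local Hilbert spaces `ℂ ^ d p`: for every player and every input
a two-outcome measurement (POVM). -/
structure LocalMeasurements {P : Type} (d : P → ℕ) where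
  M : ∀ p, Option Bool → Bool → Matrix (Fin (d p)) (Fin (d p)) ℂ
  posSemidef : ∀ p a x, (M p a x).PosSemidef
  sum_eq_one : ∀ p a, ∑ x, M p a x = 1

/-- The tensor product of operators on the local spaces, as an operator on `⨂ p, ℂ ^ d p`. -/
def tensorMatrix {P : Type} [Fintype P] {d : P → ℕ}
    (M : ∀ p, Matrix (Fin (d p)) (Fin (d p)) ℂ) :
    Matrix (∀ p, Fin (d p)) (∀ p, Fin (d p)) ℂ :=
  Matrix.of fun i j => ∏ p, M p (i p) (j p)

/-- The correlation that quantum players generate by measuring a shared state `ρ` (Born rule). -/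
noncomputable def quantumCorrelation {P : Type} [Fintype P] [DecidableEq P] {d : P → ℕ}
    (ρ : Matrix (∀ p, Fin (d p)) (∀ p, Fin (d p)) ℂ) (E : LocalMeasurements d) :
    Correlation P := fun a x =>
  (Matrix.trace (tensorMatrix (fun p => E.M p (a p) (x p)) * ρ)).re

/-- The GHZ state vector `(|0…0⟩ + |1…1⟩) / √2`, one qubit for each player. -/
noncomputable def ghzVector (P : Type) [Fintype P] [DecidableEq P] : (P → Fin 2) → ℂ :=
  ((1 / Real.sqrt 2 : ℝ) : ℂ) • (Pi.single (fun _ => 0) 1 + Pi.single (fun _ => 1) 1)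

/-- The density matrix of the GHZ state. -/
noncomputable def ghzState (P : Type) [Fintype P] [DecidableEq P] :
    Matrix (P → Fin 2) (P → Fin 2) ℂ :=
  Matrix.vecMulVec (ghzVector P) (star (ghzVector P))

/-! ## The game `CHSH + k` -/

/-- The players Alice, Bob and Charlie₁, …, Charlie_k. -/
inductive Player (k : ℕ) : Type
  | alice : Player k
  | bob : Player k
  | charlie (j : Fin k) : Player k
  deriving DecidableEq, Fintype

/-- The verifier's questions. -/
inductive Question (k : ℕ) : Type
  | consistency (j : Fin k) : Question k
  | game (a b : Bool) : Question k
  deriving DecidableEq, Fintype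

namespace Question

variable {k : ℕ}

/-- The inputs that the verifier sends; `none` means that the player is not asked. -/
def input : Question k → Player k → Option Bool
  | consistency _, .alice => some false
  | consistency _, .bob => none
  | consistency j, .charlie i => if i = j then some false else none
  | game a _, .alice => some a
  | game _ b, .bob => some b
  | game a _, .charlie _ => if a then some true else none

/-- The verifier's acceptance predicate on the answers `x` of the players. -/
def Accept : Question k → (Player k → Bool) → Prop
  | consistency j, x => x .alice = x (.charlie j)
  | game false _, x => x .alice = x .bob
  | game true b, x =>
      (if x .alice then 1 else 0) + (∑ j : Fin k, if x (.charlie j) then 1 else 0)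
        + (if x .bob then 1 else 0) = ((if b then 1 else 0) : ZMod 2)

end Question

/-- The probability of asking a consistency question. -/
noncomputable def consistencyProb (k : ℕ) : ℝ := 1 - 2 / (3 ^ k + 1)

/-- The probability with which the verifier asks a question: a consistency question with
probability `consistencyProb k`, its index uniform, and else a game question with uniformly
random input bits. -/
noncomputable def Question.prob {k : ℕ} : Question k → ℝ
  | consistency _ => consistencyProb k / k
  | game _ _ => (1 - consistencyProb k) / 4

open Classical in
/-- The probability that players with the given correlation win the game `CHSH + k`. -/
noncomputable def winProb (k : ℕ) (c : Correlation (Player k)) : ℝ :=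
  ∑ Q : Question k, Q.prob * ∑ x : Player k → Bool, if Q.Accept x then c Q.input x else 0

/-- The quantum value of `CHSH + k`: the supremum of the winning probabilities of quantum players
over all finite-dimensional shared states and all local measurements. -/
noncomputable def quantumValue (k : ℕ) : ℝ :=
  sSup {w : ℝ | ∃ (d : Player k → ℕ) (ρ : Matrix (∀ p, Fin (d p)) (∀ p, Fin (d p)) ℂ)
    (E : LocalMeasurements d), ρ.PosSemidef ∧ ρ.trace = 1 ∧
      w = winProb k (quantumCorrelation ρ E)}

/-! Classical bound. Every resource involves at most `k + 1` of the `k + 2` players, so it misses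
some player, its class `cls i`. Put Alice and all Charlies on input `0` and Bob on input `b`, and
disconnect Bob from the resources one class at a time by handing him fresh copies
(`NSResource.cutWeight`). A resource of class Charlie_j does not involve Charlie_j, so cutting it
cannot be seen in the joint answers of Bob and Charlie_j; and Alice agrees with Charlie_j up to the
loss on the consistency question `j`, whether or not Bob is cut off. Going from Alice to Charlie_j,
cutting, and going back costs twice that loss (`expect_disagree_bob_alice_le`). Once all Charlie
classes are cut, the remaining resources cannot correlate Alice with Bob, so their answers are
independent (`expect_disagree_of_split`).

For `A = 1` only a marginal is needed: the parity of the others does not depend on `B`, so a winning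
Bob must answer nearly oppositely on his two inputs, whereas for `A = 0` he must reproduce the same
answer of Alice. For independent answers these demands conflict (`one_le_chsh_loss`), whence
`one_le_sum_lossProb`. This inequality weights consistency questions four times as heavily as game
questions; by Bernoulli's inequality `1 + 2k ≤ 3 ^ k` the verifier weights them at least as heavily
as that.

Quantum bound. On the GHZ state, measuring `Z` on input `0` gives perfect agreement of Alice and the
Charlies, and the product of `X` measurements on input `1` combines with Bob's tilted measurement as
in the optimal CHSH strategy. Consistency is never lost, and each game question is lost with
probability `sin² (π / 8)`. -/

/-! ## Weights on transcripts -/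

section Weights

variable {P : Type} [DecidableEq P]

/-- A weight on the tuples of transcripts of all players with the properties of the conditional
probabilities of a non-signaling resource of the same type as `R`. -/
structure IsNonsignaling (R : NSResource.{u} P)
    (W : (∀ p, List (R.In p × R.Out p)) → ℝ≥0∞) : Prop where
  nil : W (fun _ => []) = 1
  step : ∀ t, ∀ p ∈ R.parties, ∀ a : R.In p,
    ∑' x : R.Out p, W (Function.update t p (t p ++ [(a, x)])) = W t
  dependsOn : DependsOn W (R.parties : Set P)

/-- The weight of a resource: the transcripts of the players that take no part are ignored. -/
def NSResource.weight (R : NSResource.{u} P) (t : ∀ p, List (R.In p × R.Out p)) : ℝ≥0∞ :=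
  R.prob fun p => t p

/-- The weight that results when player `b` uses a fresh copy of the resource. -/
noncomputable def NSResource.cutWeight (R : NSResource.{u} P) (b : P)
    (t : ∀ p, List (R.In p × R.Out p)) : ℝ≥0∞ :=
  R.weight (Function.update (fun _ => []) b (t b)) * R.weight (Function.update t b [])

theorem NSResource.isNonsignaling_weight (R : NSResource.{u} P) : IsNonsignaling R R.weight where
  nil := R.prob_nil
  step t p hp a := by
    rw [NSResource.weight, ← R.nonsignaling (fun q => t q) ⟨p, hp⟩ a]
    refine tsum_congr fun x => congrArg R.prob (funext fun q => ?_)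
    by_cases h : q = ⟨p, hp⟩
    · subst h; simp
    · have h' : (q : P) ≠ p := fun e => h (Subtype.ext e)
      simp [h, h']
  dependsOn t t' h := congrArg R.prob (funext fun q => h q q.2)

/-- A further input of one player changes exactly one of the two factors, the first for `b` and the
second for anyone else; the other factor leaves the sum. -/
theorem NSResource.isNonsignaling_cutWeight (R : NSResource.{u} P) (b : P) :
    IsNonsignaling R (R.cutWeight b) where
  nil := by
    have h := R.isNonsignaling_weight.nil
    rw [NSResource.cutWeight, show Function.update (fun p : P => ([] : List (R.In p × R.Out p))) b []
      = fun _ => [] from Function.update_eq_self b _, h, one_mul]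
  step t p hp a := by
    have hs := R.isNonsignaling_weight.step
    by_cases h : p = b
    · subst h
      simp only [NSResource.cutWeight, Function.update_self, Function.update_idem]
      rw [ENNReal.tsum_mul_right]
      congr 1
      simpa using hs (Function.update (fun _ => []) p (t p)) p hp a
    · have h' : b ≠ p := fun e => h e.symm
      simp only [NSResource.cutWeight, Function.update_of_ne h']
      rw [ENNReal.tsum_mul_left]
      congr 1
      rw [← hs (Function.update t b []) p hp a]
      refine tsum_congr fun x => ?_
      rw [Function.update_comm h, Function.update_of_ne h]
  dependsOn t t' h := by
    have hd := R.isNonsignaling_weight.dependsOn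
    refine congrArg₂ (· * ·) (hd fun q hq => ?_) (hd fun q hq => ?_)
    · by_cases e : q = b
      · subst e; simpa using h q hq
      · simp [e]
    · by_cases e : q = b
      · subst e; simp
      · simpa [e] using h q hq

theorem NSResource.weight_nil (R : NSResource.{u} P) : R.weight (fun _ => []) = 1 :=
  R.prob_nil

theorem NSResource.cutWeight_of_nil (R : NSResource.{u} P) {b : P}
    {t : ∀ p, List (R.In p × R.Out p)} (h : t b = []) : R.cutWeight b t = R.weight t := by
  have h1 : Function.update (fun p : P => ([] : List (R.In p × R.Out p))) b [] = fun _ => [] :=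
    Function.update_eq_self b _
  have h2 : Function.update t b [] = t := by rw [← h]; exact Function.update_eq_self b t
  rw [NSResource.cutWeight, h, h1, h2, R.weight_nil, one_mul]

/-- If no participant of the resource other than `b` has used it, then `b` may as well use a
fresh copy; likewise if `b` does not take part. -/
theorem NSResource.cutWeight_eq_weight (R : NSResource.{u} P) {b : P}
    {t : ∀ p, List (R.In p × R.Out p)}
    (h : b ∉ R.parties ∨ ∀ p ∈ R.parties, p ≠ b → t p = []) : R.cutWeight b t = R.weight t := by
  have hd := R.isNonsignaling_weight.dependsOn
  rcases h with h | h
  · rw [R.isNonsignaling_cutWeight b |>.dependsOn (y := Function.update t b []) fun p hp => ?_,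
      R.cutWeight_of_nil (by simp), hd fun p hp => ?_] <;>
    · have : p ≠ b := fun e => h (e ▸ hp)
      simp [this]
  · rw [NSResource.cutWeight, hd (x := Function.update t b []) (y := fun _ => []) fun p hp => ?_,
      R.weight_nil, mul_one]
    · refine hd fun p hp => ?_
      by_cases e : p = b
      · subst e; simp
      · simp [e, h p hp e]
    · by_cases e : p = b
      · subst e; simp
      · simp [e, h p hp e]

theorem NSResource.cutWeight_mul (R : NSResource.{u} P) {b : P}
    (t : ∀ p, List (R.In p × R.Out p)) : R.cutWeight b t =
      R.cutWeight b (Function.update (fun _ => []) b (t b)) *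
        R.cutWeight b (Function.update t b []) := by
  have h1 : R.cutWeight b (Function.update (fun _ => []) b (t b)) =
      R.weight (Function.update (fun _ => []) b (t b)) :=
    R.cutWeight_eq_weight (Or.inr fun p _ e => by simp [e])
  rw [h1, R.cutWeight_of_nil (t := Function.update t b []) (by simp), NSResource.cutWeight]

end Weights

/-! ## Expectations over the runs of programs -/

section Expect

variable {P : Type} [DecidableEq P] {m : ℕ} {R : Fin m → NSResource.{u} P}

/-- No-signaling survives adaptive use of several resources: the continuation after the first output
sums out by induction, with the first query appended to the history, and then `step` sums out that
output. The arbitrary history `t` is what makes the induction work. -/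
theorem Program.tsum_run_prod {W : ∀ i, (∀ p, List ((R i).In p × (R i).Out p)) → ℝ≥0∞}
    (hW : ∀ i, IsNonsignaling (R i) (W i)) {p : P} (T : Program R p)
    (t : ∀ i, ∀ q, List ((R i).In q × (R i).Out q)) :
    ∑' r : T.Run, ∏ i, W i (Function.update (t i) p (t i p ++ T.transcript r i)) =
      ∏ i, W i (t i) := by
  induction T generalizing t with
  | answer b =>
    have : Unique (Program.answer b : Program R p).Run := inferInstanceAs (Unique PUnit)
    rw [tsum_fintype, Fintype.sum_unique]
    simp [Program.transcript]
  | query i hp a next ih =>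
    change ∑' r : (Σ x : (R i).Out p, (next x).Run), _ = _
    rw [ENNReal.tsum_sigma']
    have key : ∀ x : (R i).Out p, ∑' r : (next x).Run,
        ∏ i', W i' (Function.update (t i') p
          (t i' p ++ (Program.query i hp a next).transcript ⟨x, r⟩ i')) =
        W i (Function.update (t i) p (t i p ++ [(a, x)])) * ∏ i' ∈ Finset.univ.erase i, W i' (t i') := by
      intro x
      have h := ih x (Function.update t i (Function.update (t i) p (t i p ++ [(a, x)])))
      rw [← Finset.mul_prod_erase _ _ (Finset.mem_univ i)] at h
      rw [Function.update_self] at h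
      rw [Finset.prod_congr rfl (g := fun i' => W i' (t i')) fun i' hi' => by
        rw [Function.update_of_ne (Finset.ne_of_mem_erase hi')]] at h
      rw [← h]
      refine tsum_congr fun r => Finset.prod_congr rfl fun i' _ => ?_
      by_cases e : i' = i
      · subst e; simp [Program.transcript]
      · simp [Program.transcript, e]
    rw [tsum_congr key, ENNReal.tsum_mul_right, (hW i).step (t i) p hp a,
      Finset.mul_prod_erase _ (fun i' => W i' (t i')) (Finset.mem_univ i)]

/-- The expectation of a function of the answers, when the programs `T` are run on resources
with the weights `W`. -/
noncomputable def expect (W : ∀ i, (∀ p, List ((R i).In p × (R i).Out p)) → ℝ≥0∞)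
    (T : ∀ p, Program R p) (F : (P → Bool) → ℝ≥0∞) : ℝ≥0∞ :=
  ∑' r : ∀ p, (T p).Run, F (fun p => (T p).result (r p)) *
    ∏ i, W i (fun p => (T p).transcript (r p) i)

/-- The answers of the players other than `p`, and an arbitrary answer of `p`. -/
def restResult {p : P} (T : ∀ q : {q // q ≠ p}, Program R q.1) (r : ∀ q, (T q).Run) (q : P) :
    Bool :=
  if h : q ≠ p then (T ⟨q, h⟩).result (r ⟨q, h⟩) else false

/-- The transcripts of the players other than `p`, and the empty transcript of `p`. -/
def restTranscript {p : P} (T : ∀ q : {q // q ≠ p}, Program R q.1) (r : ∀ q, (T q).Run)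
    (i : Fin m) (q : P) : List ((R i).In q × (R i).Out q) :=
  if h : q ≠ p then (T ⟨q, h⟩).transcript (r ⟨q, h⟩) i else []

variable {W : ∀ i, (∀ p, List ((R i).In p × (R i).Out p)) → ℝ≥0∞}

theorem tsum_eq_tsum_rest {α : P → Type u} (p : P) (f : (∀ q, α q) → ℝ≥0∞) :
    ∑' r, f r = ∑' r : ∀ q : {q // q ≠ p}, α q, ∑' x, f ((Equiv.piSplitAt p α).symm (x, r)) := by
  rw [← (Equiv.piSplitAt p α).symm.tsum_eq f, ENNReal.tsum_comm]
  exact ENNReal.tsum_prod (f := fun x r => f ((Equiv.piSplitAt p α).symm (x, r)))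

theorem expect_eq_tsum_rest (p : P) (T : ∀ p, Program R p) (F : (P → Bool) → ℝ≥0∞) :
    expect W T F = ∑' r : ∀ q : {q // q ≠ p}, (T q).Run, ∑' x : (T p).Run,
      F (Function.update (restResult (fun q => T q) r) p ((T p).result x)) *
        ∏ i, W i (Function.update (restTranscript (fun q => T q) r i) p
          ((T p).transcript x i)) := by
  rw [expect, tsum_eq_tsum_rest p]
  refine tsum_congr fun r => tsum_congr fun x => ?_
  congr 2
  · funext q
    by_cases h : q = p
    · subst h; simp [Equiv.piSplitAt]
    · simp [Equiv.piSplitAt, h, restResult]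
  · funext i
    congr 1
    funext q
    by_cases h : q = p
    · subst h; simp [Equiv.piSplitAt]
    · simp [Equiv.piSplitAt, h, restTranscript]

theorem update_restTranscript {p : P} (T : ∀ q : {q // q ≠ p}, Program R q.1)
    (r : ∀ q, (T q).Run) (i : Fin m) :
    Function.update (restTranscript T r i) p [] = restTranscript T r i := by
  rw [Function.update_eq_self_iff]; simp [restTranscript]

theorem tsum_run_rest (hW : ∀ i, IsNonsignaling (R i) (W i)) {p : P} (T : Program R p)
    (t : ∀ i, ∀ q, List ((R i).In q × (R i).Out q)) (ht : ∀ i, t i p = []) :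
    ∑' x : T.Run, ∏ i, W i (Function.update (t i) p (T.transcript x i)) = ∏ i, W i (t i) := by
  simpa [ht] using T.tsum_run_prod hW t

/-- A player whose answer is ignored does not matter. -/
theorem expect_marginal (hW : ∀ i, IsNonsignaling (R i) (W i)) (p : P) (T : ∀ p, Program R p)
    {F : (P → Bool) → ℝ≥0∞} (hF : DependsOn F {p}ᶜ) :
    expect W T F = ∑' r : ∀ q : {q // q ≠ p}, (T q).Run,
      F (restResult (fun q => T q) r) * ∏ i, W i (restTranscript (fun q => T q) r i) := by
  rw [expect_eq_tsum_rest p]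
  refine tsum_congr fun r => ?_
  rw [← tsum_run_rest hW (T p) _ fun i => by simp [restTranscript], ← ENNReal.tsum_mul_left]
  refine tsum_congr fun x => congrArg (· * _) (hF fun q hq => ?_)
  exact Function.update_of_ne hq _ _

theorem expect_eq_of_eq_off (hW : ∀ i, IsNonsignaling (R i) (W i)) (p : P)
    {T T' : ∀ p, Program R p} (h : ∀ q, q ≠ p → T q = T' q)
    {F : (P → Bool) → ℝ≥0∞} (hF : DependsOn F {p}ᶜ) : expect W T F = expect W T' F := by
  have e : (fun q : {q // q ≠ p} => T q) = fun q : {q // q ≠ p} => T' q := funext fun q => h q q.2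
  -- The types of the runs depend on the programs, so the equality is substituted for variables
  -- instead of rewritten.
  have key : ∀ S S' : ∀ q : {q // q ≠ p}, Program R q.1, S = S' →
      (∑' r : ∀ q, (S q).Run, F (restResult S r) * ∏ i, W i (restTranscript S r i)) =
        ∑' r : ∀ q, (S' q).Run, F (restResult S' r) * ∏ i, W i (restTranscript S' r i) := by
    rintro S _ rfl; rfl
  rw [expect_marginal hW p T hF, expect_marginal hW p T' hF]
  exact key _ _ e

theorem expect_mono (T : ∀ p, Program R p) {F G : (P → Bool) → ℝ≥0∞} (h : ∀ x, F x ≤ G x) :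
    expect W T F ≤ expect W T G :=
  ENNReal.tsum_le_tsum fun _ => mul_le_mul_left (h _) _

theorem expect_add (T : ∀ p, Program R p) (F G : (P → Bool) → ℝ≥0∞) :
    expect W T (fun x => F x + G x) = expect W T F + expect W T G := by
  simp only [expect, add_mul, ENNReal.tsum_add]

theorem Program.transcript_of_eq_answer {p : P} {T : Program R p} {b : Bool}
    (h : T = Program.answer b) (r : T.Run) (i : Fin m) : T.transcript r i = [] := by
  subst h; rfl

variable [Fintype P]

/-- An expectation depends only on the programs of the players whose answers matter. -/
theorem expect_congr_program (hW : ∀ i, IsNonsignaling (R i) (W i)) (s : Finset P)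
    {T T' : ∀ p, Program R p} (h : ∀ q ∈ s, T q = T' q)
    {F : (P → Bool) → ℝ≥0∞} (hF : DependsOn F (s : Set P)) : expect W T F = expect W T' F := by
  suffices H : ∀ u : Finset P, Disjoint u s →
      expect W T F = expect W (fun q => if q ∈ u then T' q else T q) F by
    rw [H sᶜ disjoint_compl_left]
    congr 1
    funext q
    by_cases hq : q ∈ s <;> simp [hq, h]
  intro u
  induction u using Finset.induction_on with
  | empty => simp
  | insert p u hp ih =>
    intro hd
    rw [Finset.disjoint_insert_left] at hd
    rw [ih hd.2]
    refine expect_eq_of_eq_off hW p (fun q hq => by simp [hq]) fun x y hxy => hF fun q hq => ?_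
    exact hxy q fun e => hd.1 (e ▸ hq)

/-- An expectation depends only on the programs of the players whose answers matter and on the
weights of their transcripts. -/
theorem expect_congr {W' : ∀ i, (∀ p, List ((R i).In p × (R i).Out p)) → ℝ≥0∞}
    (hW : ∀ i, IsNonsignaling (R i) (W i)) (hW' : ∀ i, IsNonsignaling (R i) (W' i))
    (s : Finset P) (hWW' : ∀ i t, (∀ p ∉ s, t p = []) → W i t = W' i t)
    {T T' : ∀ p, Program R p} (h : ∀ q ∈ s, T q = T' q)
    {F : (P → Bool) → ℝ≥0∞} (hF : DependsOn F (s : Set P)) : expect W T F = expect W' T' F := by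
  -- Irrelevant players answer at once, so that their transcripts are empty and `hWW'` applies.
  let T₀ : ∀ p, Program R p := fun p => if p ∈ s then T p else Program.answer false
  rw [expect_congr_program hW s (T' := T₀) (fun q hq => by simp [T₀, hq]) hF,
    expect_congr_program hW' s (T := T') (T' := T₀) (fun q hq => by simp [T₀, hq, h]) hF]
  refine tsum_congr fun r => congrArg (_ * ·) (Finset.prod_congr rfl fun i _ => ?_)
  exact hWW' i _ fun p hp => Program.transcript_of_eq_answer (if_neg hp) _ _

theorem expect_one (hW : ∀ i, IsNonsignaling (R i) (W i)) (T : ∀ p, Program R p) :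
    expect W T (fun _ => 1) = 1 := by
  rw [expect_congr_program hW ∅ (T' := fun _ => Program.answer false) (by simp)
    fun _ _ _ => rfl]
  have : Unique (∀ p : P, (Program.answer false : Program R p).Run) :=
    inferInstanceAs (Unique (∀ p : P, PUnit))
  rw [expect, tsum_fintype, Fintype.sum_unique]
  simp [Program.transcript, (hW _).nil]

/-- If all weights split off the transcripts of `b`, then `b` is independent of the others. -/
theorem expect_mul_of_split (hW : ∀ i, IsNonsignaling (R i) (W i)) (b : P)
    (hs : ∀ i t, W i t = W i (Function.update (fun _ => []) b (t b)) *
      W i (Function.update t b []))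
    (T : ∀ p, Program R p) {F G : (P → Bool) → ℝ≥0∞}
    (hF : DependsOn F {b}) (hG : DependsOn G {b}ᶜ) :
    expect W T (fun x => F x * G x) = expect W T F * expect W T G := by
  have key : ∀ F G : (P → Bool) → ℝ≥0∞, DependsOn F {b} → DependsOn G {b}ᶜ →
      expect W T (fun x => F x * G x) =
        (∑' x : (T b).Run, F (Function.update (fun _ => false) b ((T b).result x)) *
          ∏ i, W i (Function.update (fun _ => []) b ((T b).transcript x i))) *
        expect W T G := by
    intro F G hF hG
    rw [expect_marginal hW b T hG, expect_eq_tsum_rest b, ← ENNReal.tsum_mul_left]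
    refine tsum_congr fun r => ?_
    rw [← ENNReal.tsum_mul_right]
    refine tsum_congr fun x => ?_
    rw [hF (y := Function.update (fun _ => false) b ((T b).result x)) fun q hq => by
        obtain rfl : q = b := hq
        simp,
      hG (y := restResult (fun q => T q) r) fun q hq => Function.update_of_ne hq _ _]
    simp_rw [hs _ (Function.update (restTranscript _ r _) b _), Finset.prod_mul_distrib,
      Function.update_idem, update_restTranscript, Function.update_self]
    ring
  -- The case `G = 1` identifies the explicit first factor as the expectation of `F`.
  have h1 := key F (fun _ => 1) hF fun _ _ _ => rfl
  rw [expect_one hW, mul_one] at h1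
  rw [key F G hF hG, ← h1]
  simp

theorem sum_answerProb (T : ∀ p, Program R p) (p : (P → Bool) → Prop) [DecidablePred p] :
    ∑ x, (if p x then answerProb T x else 0) =
      expect (fun i => (R i).weight) T (fun x => if p x then 1 else 0) := by
  simp only [expect, answerProb]
  simp_rw [← Finset.sum_filter]
  rw [← Summable.tsum_finsetSum fun _ _ => ENNReal.summable]
  refine tsum_congr fun r => ?_
  rw [Finset.sum_filter]
  simp only [← ite_and]
  by_cases h : p fun q => (T q).result (r q)
  · rw [Finset.sum_eq_single fun q => (T q).result (r q)]
    · simp [h]; rfl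
    · intro x _ hx; rw [if_neg]; exact fun h => hx h.2.symm
    · simp
  · rw [if_neg h, zero_mul]
    refine Finset.sum_eq_zero fun x _ => ?_
    rw [if_neg]
    rintro ⟨h1, h2⟩
    exact h (h2 ▸ h1)

end Expect

/-! ## Non-signaling strategies for `CHSH + k` -/

section Game

/-- The CHSH inequality for independent bits of Alice and Bob: `x`, `y₀`, `y₁` are the
probabilities that Alice on input `0` and Bob on either input answer `1`, and `w` is the
probability that the other players' parity on input `1` is `1`. -/
theorem one_le_chsh_loss {x x' y₀ y₀' y₁ y₁' w w' e₀ e₁ : ℝ≥0∞} (hx : x + x' = 1)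
    (hy₀ : y₀ + y₀' = 1) (hy₁ : y₁ + y₁' = 1) (hw : w + w' = 1) (h₁ : y₀ ≤ w + e₀)
    (h₂ : w ≤ y₀ + e₀) (h₃ : y₁ ≤ w' + e₁) (h₄ : w' ≤ y₁ + e₁) :
    1 ≤ (y₀ * x' + y₀' * x) + (y₁ * x' + y₁' * x) + (e₀ + e₁) := by
  by_cases he₀ : e₀ = ⊤
  · simp [he₀]
  by_cases he₁ : e₁ = ⊤
  · simp [he₁]
  have hfin : ∀ {a b : ℝ≥0∞}, a + b = 1 → a ≠ ⊤ ∧ b ≠ ⊤ := fun h =>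
    ENNReal.add_ne_top.1 (h ▸ ENNReal.one_ne_top)
  obtain ⟨f₁, f₂⟩ := hfin hx
  obtain ⟨f₃, f₄⟩ := hfin hy₀
  obtain ⟨f₅, f₆⟩ := hfin hy₁
  obtain ⟨f₇, f₈⟩ := hfin hw
  lift x to NNReal using f₁
  lift x' to NNReal using f₂
  lift y₀ to NNReal using f₃
  lift y₀' to NNReal using f₄
  lift y₁ to NNReal using f₅
  lift y₁' to NNReal using f₆
  lift w to NNReal using f₇
  lift w' to NNReal using f₈
  lift e₀ to NNReal using he₀
  lift e₁ to NNReal using he₁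
  norm_cast at *
  rw [← NNReal.coe_le_coe] at *
  rw [← NNReal.coe_inj] at *
  push_cast at *
  obtain ⟨n₁, n₂⟩ : (0 : ℝ) ≤ x ∧ (0 : ℝ) ≤ x' := ⟨x.2, x'.2⟩
  rw [show (x' : ℝ) = 1 - x by linarith, show (y₀' : ℝ) = 1 - y₀ by linarith,
    show (y₁' : ℝ) = 1 - y₁ by linarith]
  -- With `s = y₀ + y₁`, the first two terms form the convex combination `s (1 - x) + (2 - s) x`,
  -- which is at least `1 - |s - 1|`, while `|s - 1| ≤ e₀ + e₁`.
  rcases le_total 0 ((y₀ : ℝ) + y₁ - 1) with h | h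
  · nlinarith [mul_nonneg h n₂]
  · nlinarith [mul_nonneg (neg_nonneg.2 h) n₁]

variable {k m : ℕ} {R : Fin m → NSResource.{u} (Player k)}

/-- The indicator of the event that two players give different answers. -/
noncomputable def disagree {P : Type} (p q : P) (x : P → Bool) : ℝ≥0∞ := if x p ≠ x q then 1 else 0

theorem dependsOn_disagree {P : Type} [DecidableEq P] (p q : P) :
    DependsOn (disagree p q) (({p, q} : Finset P) : Set P) := fun x y h => by
  simp [disagree, h p (by simp), h q (by simp)]

theorem disagree_triangle {P : Type} (p q r : P) (x : P → Bool) :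
    disagree p r x ≤ disagree p q x + disagree q r x := by
  unfold disagree
  cases x p <;> cases x q <;> cases x r <;> simp

open Classical in
/-- The probability of losing on the question `Q`. -/
noncomputable def lossProb (T : ∀ p, Option Bool → Program R p) (Q : Question k) : ℝ≥0∞ :=
  expect (fun i => (R i).weight) (fun p => T p (Q.input p)) fun x => if ¬ Q.Accept x then 1 else 0

theorem lossProb_consistency (T : ∀ p, Option Bool → Program R p) (j : Fin k) :
    lossProb T (.consistency j) = expect (fun i => (R i).weight)
      (fun p => T p ((Question.consistency j).input p)) (disagree .alice (.charlie j)) := by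
  unfold lossProb
  congr 1
  funext x
  by_cases h : x .alice = x (.charlie j) <;> simp [Question.Accept, disagree, h]

theorem lossProb_game_false (T : ∀ p, Option Bool → Program R p) (b : Bool) :
    lossProb T (.game false b) = expect (fun i => (R i).weight)
      (fun p => T p ((Question.game false b : Question k).input p)) (disagree .bob .alice) := by
  unfold lossProb
  congr 1
  funext x
  by_cases h : x .alice = x .bob <;> simp [Question.Accept, disagree, h, eq_comm]

/-- The inputs of the game question `(0, b)`, with all Charlies on input `0` in addition. -/
def jointInput (b : Bool) : Player k → Option Bool
  | .alice => some false
  | .bob => some b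
  | .charlie _ => some false

/-- The resources, with Bob on a fresh copy of those whose class lies in `S`. -/
noncomputable def cutWeights (R : Fin m → NSResource.{u} (Player k)) (cls : Fin m → Player k)
    (S : Finset (Player k)) (i : Fin m) :
    (∀ p, List ((R i).In p × (R i).Out p)) → ℝ≥0∞ :=
  if cls i ∈ S then (R i).cutWeight .bob else (R i).weight

variable {cls : Fin m → Player k}

theorem isNonsignaling_cutWeights (S : Finset (Player k)) (i : Fin m) :
    IsNonsignaling (R i) (cutWeights R cls S i) := by
  unfold cutWeights
  split_ifs
  exacts [(R i).isNonsignaling_cutWeight _, (R i).isNonsignaling_weight]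

/-- Bob's answer is ignored, so neither his input nor his being cut off matters; nor do the inputs
of the other Charlies. -/
theorem expect_disagree_alice_charlie (T : ∀ p, Option Bool → Program R p)
    (S : Finset (Player k)) (b : Bool) (j : Fin k) :
    expect (cutWeights R cls S) (fun p => T p (jointInput b p)) (disagree .alice (.charlie j)) =
      lossProb T (.consistency j) := by
  rw [lossProb_consistency]
  refine expect_congr (isNonsignaling_cutWeights S) (fun i => (R i).isNonsignaling_weight)
    {.alice, .charlie j} (fun i t ht => ?_) ?_ ?_
  · unfold cutWeights
    split_ifs
    exacts [(R i).cutWeight_of_nil (ht _ (by simp)), rfl]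
  · simp [jointInput, Question.input]
  · exact dependsOn_disagree _ _

/-- Hybrid argument over the classes: each newly cut Charlie is used as an intermediary between Bob
and Alice, once before and once after the cut, which explains the factor `2`. -/
theorem expect_disagree_bob_alice_le (hcls : ∀ i, cls i ∉ (R i).parties)
    (T : ∀ p, Option Bool → Program R p) (b : Bool) (S : Finset (Fin k)) :
    expect (cutWeights R cls (S.image .charlie)) (fun p => T p (jointInput b p))
        (disagree .bob .alice) ≤
      lossProb T (.game false b) + 2 * ∑ j ∈ S, lossProb T (.consistency j) := by
  induction S using Finset.induction_on with
  | empty =>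
    rw [Finset.sum_empty, mul_zero, add_zero]
    refine le_of_eq ?_
    rw [lossProb_game_false]
    refine expect_congr (isNonsignaling_cutWeights _) (fun i => (R i).isNonsignaling_weight)
      {.bob, .alice} (fun i t ht => ?_) ?_ ?_
    · simp [cutWeights]
    · simp [jointInput, Question.input]
    · exact dependsOn_disagree _ _
  | insert j S hj ih =>
    rw [Finset.sum_insert hj]
    set J : ∀ p, Program R p := fun p => T p (jointInput b p)
    have h1 : expect (cutWeights R cls (S.image .charlie)) J (disagree .bob (.charlie j)) ≤
        expect (cutWeights R cls (S.image .charlie)) J (disagree .bob .alice) +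
          lossProb T (.consistency j) := by
      rw [← expect_disagree_alice_charlie (cls := cls) T (S.image .charlie) b j, ← expect_add]
      exact expect_mono _ fun x => disagree_triangle _ _ _ _
    -- In a resource without Charlie_j, Bob is the only possible participant among the two players
    -- observed here, so a fresh copy serves him equally well.
    have h2 : expect (cutWeights R cls ((insert j S).image .charlie)) J
        (disagree .bob (.charlie j)) =
          expect (cutWeights R cls (S.image .charlie)) J (disagree .bob (.charlie j)) := by
      refine expect_congr (isNonsignaling_cutWeights _) (isNonsignaling_cutWeights _)
        {.bob, .charlie j} (fun i t ht => ?_) (fun _ _ => rfl) (dependsOn_disagree _ _)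
      unfold cutWeights
      rw [Finset.image_insert]
      by_cases hi : cls i = .charlie j
      · have hw : (R i).cutWeight .bob t = (R i).weight t :=
          (R i).cutWeight_eq_weight <| Or.inr fun p hp hpb => ht p <| by
            have : p ≠ .charlie j := fun e => hcls i (hi ▸ e ▸ hp)
            simp [hpb, this]
        split_ifs <;> simp [hw]
      · simp [hi]
    have h3 : expect (cutWeights R cls ((insert j S).image .charlie)) J (disagree .bob .alice) ≤
        expect (cutWeights R cls ((insert j S).image .charlie)) J (disagree .bob (.charlie j)) +
          lossProb T (.consistency j) := by
      rw [← expect_disagree_alice_charlie (cls := cls) T ((insert j S).image .charlie) b j,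
        ← expect_add]
      refine expect_mono _ fun x => (disagree_triangle _ (.charlie j) _ _).trans_eq ?_
      simp [disagree, eq_comm]
    refine h3.trans ?_
    rw [h2]
    refine (add_le_add_left (h1.trans (add_le_add_left ih _)) _).trans_eq ?_
    ring

/-- The indicator of an answer of one player. -/
noncomputable def answers {P : Type} (p : P) (c : Bool) (x : P → Bool) : ℝ≥0∞ :=
  if x p = c then 1 else 0

theorem dependsOn_answers {P : Type} (p : P) (c : Bool) : DependsOn (answers p c) {p} :=
  fun x y h => by simp [answers, h p rfl]

theorem expect_answers_add {W : ∀ i, (∀ p, List ((R i).In p × (R i).Out p)) → ℝ≥0∞}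
    (hW : ∀ i, IsNonsignaling (R i) (W i)) (T : ∀ p, Program R p) (p : Player k) :
    expect W T (answers p true) + expect W T (answers p false) = 1 := by
  rw [← expect_add, ← expect_one hW T]
  congr 1
  funext x
  cases h : x p <;> simp [answers, h]

/-- Seen by Alice and Bob alone, the uncut resources may be cut too: each misses Alice or Bob, so it
cannot link them. Then all weights split and the joint distribution is the product of the original
marginals. -/
theorem expect_disagree_of_split (hcls : ∀ i, cls i ∉ (R i).parties)
    (T : ∀ p, Option Bool → Program R p) (b : Bool) :
    expect (cutWeights R cls (Finset.univ.image .charlie)) (fun p => T p (jointInput b p))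
        (disagree .bob .alice) =
      expect (fun i => (R i).weight) (fun p => T p (some b)) (answers .bob true) *
        expect (fun i => (R i).weight) (fun p => T p (some false)) (answers .alice false) +
      expect (fun i => (R i).weight) (fun p => T p (some b)) (answers .bob false) *
        expect (fun i => (R i).weight) (fun p => T p (some false)) (answers .alice true) := by
  have hc : ∀ i, IsNonsignaling (R i) ((R i).cutWeight .bob) := fun i =>
    (R i).isNonsignaling_cutWeight _
  have hw : ∀ i, IsNonsignaling (R i) (R i).weight := fun i => (R i).isNonsignaling_weight
  rw [expect_congr (isNonsignaling_cutWeights _) hc {.bob, .alice} (fun i t ht => ?_)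
    (fun _ _ => rfl) (dependsOn_disagree _ _)]
  · have e : (disagree .bob .alice : (Player k → Bool) → ℝ≥0∞) = fun x =>
        answers .bob true x * answers .alice false x + answers .bob false x * answers .alice true x := by
      funext x
      cases h : x .bob <;> cases h' : x .alice <;> simp [disagree, answers, h, h']
    have hA : ∀ c, DependsOn (answers (Player.alice (k := k)) c) {Player.bob}ᶜ := fun c =>
      (dependsOn_answers _ c).mono (by simp)
    rw [e, expect_add, expect_mul_of_split hc .bob (fun i t => (R i).cutWeight_mul t) _
      (dependsOn_answers _ _) (hA _), expect_mul_of_split hc .bob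
      (fun i t => (R i).cutWeight_mul t) _ (dependsOn_answers _ _) (hA _)]
    have hB : ∀ c, expect (fun i => (R i).cutWeight .bob) (fun p => T p (jointInput b p))
        (answers .bob c) = expect (fun i => (R i).weight) (fun p => T p (some b))
          (answers .bob c) := fun c =>
      expect_congr hc hw {.bob} (fun i t ht => (R i).cutWeight_eq_weight <|
        Or.inr fun p _ hp => ht p (by simpa using hp)) (by simp [jointInput])
        (by simpa using dependsOn_answers _ _)
    have hA' : ∀ c, expect (fun i => (R i).cutWeight .bob) (fun p => T p (jointInput b p))
        (answers .alice c) = expect (fun i => (R i).weight) (fun p => T p (some false))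
          (answers .alice c) := fun c =>
      expect_congr hc hw {.alice} (fun i t ht => (R i).cutWeight_of_nil (ht _ (by simp)))
        (by simp [jointInput]) (by simpa using dependsOn_answers _ _)
    rw [hB, hB, hA', hA']
  · unfold cutWeights
    split_ifs with hi
    · rfl
    · refine ((R i).cutWeight_eq_weight ?_).symm
      cases hci : cls i with
      | bob => exact Or.inl (hci ▸ hcls i)
      | charlie j => simp [hci] at hi
      | alice =>
        refine Or.inr fun p hp hpb => ht p ?_
        have : p ≠ .alice := fun e => hcls i (hci ▸ e ▸ hp)
        simp [hpb, this]

/-- The parity of the answers of all players but Bob. -/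
def parity (x : Player k → Bool) : ZMod 2 :=
  (if x .alice then 1 else 0) + ∑ j : Fin k, if x (.charlie j) then 1 else 0

/-- The indicator of a value of the parity. -/
noncomputable def hasParity (c : ZMod 2) (x : Player k → Bool) : ℝ≥0∞ :=
  if parity x = c then 1 else 0

theorem dependsOn_hasParity (c : ZMod 2) :
    DependsOn (hasParity (k := k) c) ((Finset.univ.erase Player.bob : Finset (Player k)) : Set (Player k)) := by
  intro x y h
  have h1 : x .alice = y .alice := h _ (by simp)
  have h2 : ∀ j, x (.charlie j) = y (.charlie j) := fun j => h _ (by simp)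
  simp [hasParity, parity, h1, h2]

theorem zmod_two_eq_zero_or_one (c : ZMod 2) : c = 0 ∨ c = 1 := by
  revert c; decide

/-- On the game questions with `A = 1`, a losing answer is the only way in which Bob's answer can
deviate from the one that the parity of the others demands. -/
theorem expect_answers_hasParity_le (T : ∀ p, Option Bool → Program R p) (b : Bool) :
    -- The parity of the others for which winning requires Bob to answer `1`.
    let c : ZMod 2 := if b then 0 else 1
    expect (fun i => (R i).weight) (fun p => T p (some b)) (answers .bob true) ≤
        expect (fun i => (R i).weight) (fun p => T p (some true)) (hasParity c) +
          lossProb T (.game true b) ∧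
      expect (fun i => (R i).weight) (fun p => T p (some true)) (hasParity c) ≤
        expect (fun i => (R i).weight) (fun p => T p (some b)) (answers .bob true) +
          lossProb T (.game true b) := by
  intro c
  have hw : ∀ i, IsNonsignaling (R i) (R i).weight := fun i => (R i).isNonsignaling_weight
  rw [expect_congr_program hw {.bob}
      (T' := fun p => T p ((Question.game true b : Question k).input p))
      (by simp [Question.input]) (by simpa using dependsOn_answers _ _),
    expect_congr_program hw (Finset.univ.erase .bob) (F := hasParity c)
      (T' := fun p => T p ((Question.game true b : Question k).input p))
      (fun q hq => ?_) (dependsOn_hasParity c), lossProb, ← expect_add, ← expect_add]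
  · have key : ∀ x : Player k → Bool, (Question.game true b).Accept x ↔
        parity x + (if x .bob then 1 else 0) = ((if b then 1 else 0) : ZMod 2) := fun x => Iff.rfl
    constructor <;>
    · refine expect_mono _ fun x => ?_
      simp only [key, hasParity, answers, c]
      rcases zmod_two_eq_zero_or_one (parity x) with h | h <;> cases x .bob <;> cases b <;>
        simp [h, CharTwo.add_self_eq_zero]
  · cases q with
    | bob => simp at hq
    | alice => rfl
    | charlie j => rfl

/-- The weighted sum of the losing probabilities of deterministic players with non-signaling
resources that each miss some player. -/
theorem one_le_sum_lossProb (hcls : ∀ i, cls i ∉ (R i).parties)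
    (T : ∀ p, Option Bool → Program R p) :
    1 ≤ ∑ a, ∑ b, lossProb T (.game a b) + 4 * ∑ j, lossProb T (.consistency j) := by
  have hw : ∀ i, IsNonsignaling (R i) (R i).weight := fun i => (R i).isNonsignaling_weight
  have hp : expect (fun i => (R i).weight) (fun p => T p (some true)) (hasParity 1) +
      expect (fun i => (R i).weight) (fun p => T p (some true)) (hasParity 0) = 1 := by
    rw [← expect_add, ← expect_one hw fun p => T p (some true)]
    congr 1
    funext x
    rcases zmod_two_eq_zero_or_one (parity x) with h | h <;> simp [hasParity, h]
  have h0 := expect_answers_hasParity_le T false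
  have h1 := expect_answers_hasParity_le T true
  refine (one_le_chsh_loss (expect_answers_add hw (fun p => T p (some false)) .alice)
    (expect_answers_add hw (fun p => T p (some false)) .bob)
    (expect_answers_add hw (fun p => T p (some true)) .bob) hp
    h0.1 h0.2 h1.1 h1.2).trans ?_
  rw [← expect_disagree_of_split hcls, ← expect_disagree_of_split hcls]
  -- Each of Bob's two inputs contributes twice the consistency losses, hence the coefficient `4`.
  refine (add_le_add_left (add_le_add (expect_disagree_bob_alice_le hcls T false Finset.univ)
    (expect_disagree_bob_alice_le hcls T true Finset.univ)) _).trans_eq ?_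
  simp only [Fintype.sum_bool]
  ring

end Game

/-! ## Sums over questions and players -/

section Sums

variable {k : ℕ}

/-- The questions as a disjoint sum. -/
def questionEquiv (k : ℕ) : Question k ≃ Fin k ⊕ (Bool × Bool) where
  toFun
    | .consistency j => .inl j
    | .game a b => .inr (a, b)
  invFun
    | .inl j => .consistency j
    | .inr (a, b) => .game a b
  left_inv Q := by cases Q <;> rfl
  right_inv Q := by rcases Q with j | ⟨a, b⟩ <;> rfl

/-- The players as a disjoint sum. -/
def playerEquiv (k : ℕ) : Player k ≃ Fin k ⊕ Bool where
  toFun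
    | .charlie j => .inl j
    | .alice => .inr false
    | .bob => .inr true
  invFun
    | .inl j => .charlie j
    | .inr false => .alice
    | .inr true => .bob
  left_inv Q := by cases Q <;> rfl
  right_inv Q := by rcases Q with j | (_ | _) <;> rfl

theorem card_player (k : ℕ) : Fintype.card (Player k) = k + 2 := by
  simp [Fintype.card_congr (playerEquiv k)]

theorem prod_player {M : Type*} [CommMonoid M] (f : Player k → M) :
    ∏ p, f p = f .alice * f .bob * ∏ j, f (.charlie j) := by
  rw [← (playerEquiv k).symm.prod_comp, Fintype.prod_sum_type, Fintype.prod_bool, mul_comm,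
    mul_comm (f .alice)]
  rfl

theorem sum_question_prob_mul (f : Question k → ℝ) :
    ∑ Q, Question.prob Q * f Q = consistencyProb k / k * ∑ j, f (.consistency j) +
      (1 - consistencyProb k) / 4 * ∑ a, ∑ b, f (.game a b) := by
  rw [← (questionEquiv k).symm.sum_comp, Fintype.sum_sum_type, Fintype.sum_prod_type]
  simp only [Finset.mul_sum]
  rfl

theorem one_sub_consistencyProb (k : ℕ) : 1 - consistencyProb k = 2 / (3 ^ k + 1) := by
  rw [consistencyProb, sub_sub_cancel]

theorem consistencyProb_div_mul (k : ℕ) : consistencyProb k / k * k = consistencyProb k := by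
  -- For `k = 0` the division by zero is harmless because `consistencyProb 0 = 0`.
  rcases eq_or_ne k 0 with rfl | hk
  · norm_num [consistencyProb]
  · field_simp

/-- This is Bernoulli's inequality `1 + 2k ≤ 3 ^ k`. -/
theorem two_mul_div_le_consistencyProb (k : ℕ) : 2 * k / (3 ^ k + 1) ≤ consistencyProb k := by
  have h := one_add_mul_le_pow (show (-2 : ℝ) ≤ 2 by norm_num) k
  rw [consistencyProb, le_sub_iff_add_le, ← add_div, div_le_one (by positivity)]
  norm_num at h
  linarith

theorem consistencyProb_nonneg (k : ℕ) : 0 ≤ consistencyProb k :=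
  le_trans (by positivity) (two_mul_div_le_consistencyProb k)

theorem question_prob_nonneg (Q : Question k) : 0 ≤ Q.prob := by
  have h0 := consistencyProb_nonneg k
  have h1 : 0 ≤ 1 - consistencyProb k := by rw [one_sub_consistencyProb]; positivity
  cases Q <;> simp only [Question.prob] <;> positivity

theorem sum_question_prob (k : ℕ) : ∑ Q : Question k, Q.prob = 1 := by
  have h := sum_question_prob_mul fun _ : Question k => (1 : ℝ)
  have h' := consistencyProb_div_mul k
  simp at h
  linarith

end Sums

/-! ## The bound for non-signaling strategies -/

section Classical

variable {k m : ℕ} {R : Fin m → NSResource.{u} (Player k)}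

theorem exists_notMem_parties (h : ∀ i, (R i).parties.card ≤ k + 1) :
    ∃ cls : Fin m → Player k, ∀ i, cls i ∉ (R i).parties := by
  have key : ∀ i, ∃ p, p ∉ (R i).parties := fun i => by
    by_contra! hp
    have := h i
    rw [Finset.eq_univ_iff_forall.2 hp, Finset.card_univ, card_player] at this
    omega
  exact ⟨fun i => (key i).choose, fun i => (key i).choose_spec⟩

theorem sum_answerProb_eq_one (T : ∀ p, Program R p) : ∑ x, answerProb T x = 1 := by
  have := sum_answerProb T fun _ => True
  simpa [expect_one fun i => (R i).isNonsignaling_weight] using this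

open Classical in
/-- The probability that a strategy loses on a question. -/
theorem NSStrategy.sum_correlation_add {n : ℕ} (S : NSStrategy.{u} (Player k) n)
    (Q : Question k) : letI := S.mΩ
    (∑ x : Player k → Bool, if Q.Accept x then S.correlation Q.input x else 0) +
      (∫⁻ ω, lossProb (S.program ω) Q ∂S.μ).toReal = 1 ∧
    (∫⁻ ω, lossProb (S.program ω) Q ∂S.μ) ≠ ⊤ ∧
    Measurable fun ω => lossProb (S.program ω) Q := by
  let _ := S.mΩ
  have _ := S.isProbabilityMeasure
  have hm := S.measurable_answerProb Q.input
  set T : S.Ω → ∀ p, Program S.resource p := fun ω p => S.program ω p (Q.input p)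
  have hloss : (fun ω => lossProb (S.program ω) Q) =
      fun ω => ∑ x, if Q.Accept x then 0 else answerProb (T ω) x := by
    funext ω
    have h := sum_answerProb (T ω) fun x => ¬ Q.Accept x
    simp only [lossProb, ite_not] at h ⊢
    exact h.symm
  have hsum : ∑ x, ∫⁻ ω, answerProb (T ω) x ∂S.μ = 1 := by
    rw [← lintegral_finsetSum _ fun x _ => hm x]
    simp [sum_answerProb_eq_one]
  have hfin : ∀ x, ∫⁻ ω, answerProb (T ω) x ∂S.μ ≠ ⊤ := fun x =>
    ne_top_of_le_ne_top ENNReal.one_ne_top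
      (hsum ▸ Finset.single_le_sum (f := fun x => ∫⁻ ω, answerProb (T ω) x ∂S.μ)
        (fun _ _ => zero_le) (Finset.mem_univ x))
  have hlint : ∫⁻ ω, lossProb (S.program ω) Q ∂S.μ =
      ∑ x, if Q.Accept x then 0 else ∫⁻ ω, answerProb (T ω) x ∂S.μ := by
    rw [hloss, lintegral_finsetSum _ fun x _ => by split_ifs; exacts [measurable_const, hm x]]
    exact Finset.sum_congr rfl fun x _ => by split_ifs <;> simp
  have hfin' : ∀ x ∈ Finset.univ, (if Q.Accept x then 0 else ∫⁻ ω, answerProb (T ω) x ∂S.μ) ≠ ⊤ :=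
    fun x _ => by split_ifs; exacts [ENNReal.zero_ne_top, hfin x]
  refine ⟨?_, ?_, ?_⟩
  · rw [hlint, ENNReal.toReal_sum hfin', ← Finset.sum_add_distrib, ← ENNReal.toReal_one, ← hsum,
      ENNReal.toReal_sum fun x _ => hfin x]
    refine Finset.sum_congr rfl fun x _ => ?_
    by_cases h : Q.Accept x
    · simp [h]; rfl
    · simp [h]
  · rw [hlint]
    exact ENNReal.sum_ne_top.2 hfin'
  · rw [hloss]
    exact Finset.measurable_sum _ fun x _ => by split_ifs; exacts [measurable_const, hm x]

theorem NSStrategy.winProb_le (S : NSStrategy.{u} (Player k) (k + 1)) :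
    winProb k S.correlation ≤ 1 - 1 / (2 * (3 ^ k + 1)) := by
  let _ := S.mΩ
  have _ := S.isProbabilityMeasure
  obtain ⟨cls, hcls⟩ := exists_notMem_parties S.card_parties_le
  set l : Question k → ℝ≥0∞ := fun Q => ∫⁻ ω, lossProb (S.program ω) Q ∂S.μ
  have hm : ∀ Q, Measurable fun ω => lossProb (S.program ω) Q := fun Q =>
    (S.sum_correlation_add Q).2.2
  have hfin : ∀ Q, l Q ≠ ⊤ := fun Q => (S.sum_correlation_add Q).2.1
  have hE : 1 ≤ ∑ a, ∑ b, l (.game a b) + 4 * ∑ j, l (.consistency j) := by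
    have h := lintegral_mono (μ := S.μ) fun ω => one_le_sum_lossProb hcls (S.program ω)
    rw [lintegral_const, measure_univ, mul_one, lintegral_add_right _
      ((Finset.measurable_sum _ fun j _ => hm _).const_mul _), lintegral_const_mul _
      (Finset.measurable_sum _ fun j _ => hm _), lintegral_finsetSum _ fun j _ => hm _,
      lintegral_finsetSum _ fun a _ => Finset.measurable_sum _ fun b _ => hm _] at h
    simpa only [lintegral_finsetSum _ fun b _ => hm (.game _ b)] using h
  have hR : 1 ≤ ∑ a, ∑ b, (l (.game a b)).toReal + 4 * ∑ j, (l (.consistency j)).toReal := by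
    have h1 : ∀ a, ∑ b, l (.game a b) ≠ ⊤ := fun a => ENNReal.sum_ne_top.2 fun b _ => hfin _
    have h2 : ∑ a, ∑ b, l (.game a b) ≠ ⊤ := ENNReal.sum_ne_top.2 fun a _ => h1 a
    have h3 : ∑ j, l (.consistency j) ≠ ⊤ := ENNReal.sum_ne_top.2 fun j _ => hfin _
    have h := ENNReal.toReal_mono
      (ENNReal.add_ne_top.2 ⟨h2, ENNReal.mul_ne_top (by simp) h3⟩) hE
    rw [ENNReal.toReal_add h2 (ENNReal.mul_ne_top (by simp) h3), ENNReal.toReal_mul,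
      ENNReal.toReal_sum fun a _ => h1 a, ENNReal.toReal_sum fun j _ => hfin _] at h
    simpa only [ENNReal.toReal_sum fun b _ => hfin (.game _ b), ENNReal.toReal_one,
      ENNReal.toReal_ofNat] using h
  have hw : winProb k S.correlation = 1 - ∑ Q : Question k, Q.prob * (l Q).toReal := by
    rw [← sum_question_prob k, ← Finset.sum_sub_distrib, winProb]
    refine Finset.sum_congr rfl fun Q _ => ?_
    rw [eq_sub_of_add_eq (S.sum_correlation_add Q).1]
    ring
  rw [hw, sum_question_prob_mul, one_sub_consistencyProb]
  -- A game question has probability `1 / (2 * (3 ^ k + 1))`; a consistency question has at least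
  -- four times that, matching the coefficients of `hR`.
  have hj : 4 * (1 / (2 * (3 ^ k + 1))) * ∑ j, (l (.consistency j)).toReal ≤
      consistencyProb k / k * ∑ j, (l (.consistency j)).toReal := by
    rcases Nat.eq_zero_or_pos k with rfl | hk
    · simp
    · refine mul_le_mul_of_nonneg_right ?_ (Finset.sum_nonneg fun _ _ => ENNReal.toReal_nonneg)
      rw [le_div_iff₀ (by positivity)]
      refine le_of_eq_of_le ?_ (two_mul_div_le_consistencyProb k)
      field_simp
      norm_num
  have hc : (0 : ℝ) ≤ 1 / (2 * (3 ^ k + 1)) := by positivity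
  have h4 : (2 : ℝ) / (3 ^ k + 1) / 4 = 1 / (2 * (3 ^ k + 1)) := by field_simp; norm_num
  rw [h4]
  nlinarith [mul_le_mul_of_nonneg_left hR hc]

end Classical

/-! ## Tensor products of local operators -/

section Tensor

open Matrix

variable {P : Type} [Fintype P] {d : P → ℕ}

theorem exists_eq_conjTranspose_mul_self {n : Type} [Fintype n] [DecidableEq n]
    {A : Matrix n n ℂ} (hA : A.PosSemidef) : ∃ B : Matrix n n ℂ, A = Bᴴ * B := by
  open scoped MatrixOrder in
  exact CStarAlgebra.nonneg_iff_eq_star_mul_self.1 (Matrix.nonneg_iff_posSemidef.2 hA)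

theorem tensorMatrix_conjTranspose (M : ∀ p, Matrix (Fin (d p)) (Fin (d p)) ℂ) :
    (tensorMatrix M)ᴴ = tensorMatrix fun p => (M p)ᴴ := by
  ext i j
  simp [tensorMatrix, conjTranspose_apply]

theorem tensorMatrix_one :
    tensorMatrix (fun p => (1 : Matrix (Fin (d p)) (Fin (d p)) ℂ)) = 1 := by
  ext i j
  simp only [tensorMatrix, of_apply, one_apply, Finset.prod_ite_zero, Finset.mem_univ,
    true_imp_iff, Finset.prod_const_one, funext_iff]

variable [DecidableEq P]

theorem tensorMatrix_mul (M N : ∀ p, Matrix (Fin (d p)) (Fin (d p)) ℂ) :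
    tensorMatrix M * tensorMatrix N = tensorMatrix fun p => M p * N p := by
  ext i j
  simp only [tensorMatrix, mul_apply, of_apply, Finset.prod_univ_sum, Fintype.piFinset_univ,
    Finset.prod_mul_distrib]

theorem sum_tensorMatrix (N : ∀ p, Bool → Matrix (Fin (d p)) (Fin (d p)) ℂ) :
    ∑ x : P → Bool, tensorMatrix (fun p => N p (x p)) = tensorMatrix fun p => ∑ b, N p b := by
  ext i j
  simp only [tensorMatrix, Matrix.sum_apply, of_apply, Finset.prod_univ_sum, Fintype.piFinset_univ]

theorem posSemidef_tensorMatrix {M : ∀ p, Matrix (Fin (d p)) (Fin (d p)) ℂ}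
    (h : ∀ p, (M p).PosSemidef) : (tensorMatrix M).PosSemidef := by
  have h' : ∀ p, ∃ B, M p = Bᴴ * B := fun p => exists_eq_conjTranspose_mul_self (h p)
  choose B hB using h'
  rw [show M = fun p => (B p)ᴴ * B p from funext hB, ← tensorMatrix_mul,
    ← tensorMatrix_conjTranspose]
  exact posSemidef_conjTranspose_mul_self _

/-- Writing `A = Cᴴ * C`, cyclicity turns the trace into that of the positive semidefinite matrix `C
* B * Cᴴ`. -/
theorem re_trace_mul_nonneg {n : Type} [Fintype n] [DecidableEq n] {A B : Matrix n n ℂ}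
    (hA : A.PosSemidef) (hB : B.PosSemidef) : 0 ≤ (A * B).trace.re := by
  obtain ⟨C, rfl⟩ := exists_eq_conjTranspose_mul_self hA
  rw [mul_assoc, trace_mul_comm]
  exact (Complex.le_def.1 (hB.mul_mul_conjTranspose_same C).trace_nonneg).1

theorem quantumCorrelation_nonneg {ρ : Matrix (∀ p, Fin (d p)) (∀ p, Fin (d p)) ℂ}
    (hρ : ρ.PosSemidef) (E : LocalMeasurements d) (a : P → Option Bool) (x : P → Bool) :
    0 ≤ quantumCorrelation ρ E a x :=
  re_trace_mul_nonneg (posSemidef_tensorMatrix fun p => E.posSemidef p _ _) hρ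

theorem sum_quantumCorrelation {ρ : Matrix (∀ p, Fin (d p)) (∀ p, Fin (d p)) ℂ}
    (hρ : ρ.trace = 1) (E : LocalMeasurements d) (a : P → Option Bool) :
    ∑ x, quantumCorrelation ρ E a x = 1 := by
  simp only [quantumCorrelation]
  rw [← Complex.re_sum, ← trace_sum, ← Finset.sum_mul,
    sum_tensorMatrix fun p b => E.M p (a p) b]
  simp_rw [E.sum_eq_one]
  simp [tensorMatrix_one, hρ]

/-- Needed for `le_csSup`: a real `sSup` dominates the members of a set only if the set is bounded
above. -/
theorem bddAbove_quantum_winProb (k : ℕ) :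
    BddAbove {w : ℝ | ∃ (d : Player k → ℕ) (ρ : Matrix (∀ p, Fin (d p)) (∀ p, Fin (d p)) ℂ)
      (E : LocalMeasurements d), ρ.PosSemidef ∧ ρ.trace = 1 ∧
        w = winProb k (quantumCorrelation ρ E)} := by
  classical
  refine ⟨1, ?_⟩
  rintro _ ⟨d, ρ, E, hρ, htr, rfl⟩
  rw [← sum_question_prob k, winProb]
  refine Finset.sum_le_sum fun Q _ => mul_le_of_le_one_right (question_prob_nonneg Q) ?_
  rw [← sum_quantumCorrelation htr E Q.input]
  refine Finset.sum_le_sum fun x _ => ?_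
  split_ifs
  exacts [le_rfl, quantumCorrelation_nonneg hρ E _ _]

end Tensor

/-! ## The GHZ strategy -/

section GHZ

open Matrix

variable {P : Type} [Fintype P] [DecidableEq P]

theorem posSemidef_ghzState : (ghzState P).PosSemidef :=
  posSemidef_vecMulVec_self_star _

/-- The GHZ state sees only the four entries of `M` at constant indices; for a tensor product each
of these is a product of local entries. -/
theorem trace_mul_ghzState (M : Matrix (P → Fin 2) (P → Fin 2) ℂ) :
    (M * ghzState P).trace = 1 / 2 * ∑ s : Fin 2, ∑ t : Fin 2, M (fun _ => s) (fun _ => t) := by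
  have h2 : ((Real.sqrt 2 : ℝ) : ℂ) ^ 2 = 2 := by
    rw [← Complex.ofReal_pow, Real.sq_sqrt (by norm_num)]; norm_num
  have h3 : ((Real.sqrt 2 : ℝ) : ℂ) ≠ 0 := by simp
  rw [ghzState, mul_vecMulVec, trace_vecMulVec, ghzVector]
  simp only [mulVec_smul, mulVec_add, mulVec_single_one, star_smul, star_add, dotProduct_smul,
    dotProduct_add, Pi.star_single, star_one, dotProduct_single_one,
    smul_eq_mul, Fin.sum_univ_two]
  simp
  field_simp
  rw [h2]
  ring

theorem trace_ghzState [Nonempty P] : (ghzState P).trace = 1 := by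
  have h := trace_mul_ghzState (P := P) 1
  rw [one_mul] at h
  rw [h]
  simp [one_apply, funext_iff]

/-- The real qubit observable with eigenvalues `±1` at the angle `θ`. -/
noncomputable def observable (θ : ℝ) : Matrix (Fin 2) (Fin 2) ℝ :=
  !![Real.cos θ, Real.sin θ; Real.sin θ, -Real.cos θ]

/-- The sign of an answer bit. -/
def bitSign (b : Bool) : ℝ := if b then -1 else 1

/-- The projections onto the eigenspaces of `observable θ`. -/
noncomputable def eigenprojection (θ : ℝ) (b : Bool) : Matrix (Fin 2) (Fin 2) ℝ :=
  (1 / 2 : ℝ) • (1 + bitSign b • observable θ)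

/-- The matrix is a real symmetric idempotent, by `sin² + cos² = 1`. -/
theorem posSemidef_eigenprojection (θ : ℝ) (b : Bool) :
    ((eigenprojection θ b).map Complex.ofReal).PosSemidef := by
  have h : (eigenprojection θ b).map Complex.ofReal =
      ((eigenprojection θ b).map Complex.ofReal)ᴴ * (eigenprojection θ b).map Complex.ofReal := by
    have hs := Real.sin_sq_add_cos_sq θ
    ext s t
    simp only [mul_apply, Fin.sum_univ_two, conjTranspose_apply, map_apply, Complex.star_def,
      Complex.conj_ofReal]
    norm_cast
    fin_cases s <;> fin_cases t <;> cases b <;>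
      simp [eigenprojection, observable, bitSign] <;> nlinarith
  rw [h]
  exact posSemidef_conjTranspose_mul_self _

/-- The measurements of the observables at given angles. -/
noncomputable def angleMeasurements (θ : P → Option Bool → ℝ) :
    LocalMeasurements (fun _ : P => 2) where
  M p a b := (eigenprojection (θ p a) b).map Complex.ofReal
  posSemidef p a b := posSemidef_eigenprojection _ _
  sum_eq_one p a := by
    ext s t
    fin_cases s <;> fin_cases t <;> simp [eigenprojection, bitSign] <;> ring

theorem quantumCorrelation_ghzState (θ : P → Option Bool → ℝ) (a : P → Option Bool)
    (x : P → Bool) : quantumCorrelation (ghzState P) (angleMeasurements θ) a x =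
      1 / 2 * ∑ s, ∑ t, ∏ p, eigenprojection (θ p (a p)) (x p) s t := by
  rw [quantumCorrelation, trace_mul_ghzState, ← Complex.ofReal_re (1 / 2 * _)]
  congr 1
  push_cast
  rfl

/-- The correlation of the answers' signs of the players in `s`. -/
theorem sum_bitSign_mul_ghz (θ : P → Option Bool → ℝ) (a : P → Option Bool) (s : P → Prop)
    [DecidablePred s] :
    ∑ x : P → Bool, (∏ p, if s p then bitSign (x p) else 1) *
        quantumCorrelation (ghzState P) (angleMeasurements θ) a x =
      1 / 2 * ∑ i, ∑ j, ∏ p, (if s p then observable (θ p (a p)) else 1) i j := by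
  simp only [quantumCorrelation_ghzState, Finset.mul_sum]
  rw [Finset.sum_comm]
  refine Finset.sum_congr rfl fun i _ => ?_
  rw [Finset.sum_comm]
  refine Finset.sum_congr rfl fun j _ => ?_
  -- The eigenprojections sum to the observable with signs and to the identity without.
  have h : ∀ p, (if s p then observable (θ p (a p)) else 1) i j = ∑ b : Bool,
      (if s p then bitSign b else 1) * eigenprojection (θ p (a p)) b i j := by
    intro p
    split_ifs <;> simp [eigenprojection, bitSign] <;> ring
  simp only [h, Finset.prod_univ_sum, Fintype.piFinset_univ, Finset.mul_sum, Finset.prod_mul_distrib]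
  exact Finset.sum_congr rfl fun x _ => by ring

end GHZ

/-! ### Winning conditions as sign products, and the GHZ value of the game -/

section GHZGame

open Matrix

variable {k : ℕ}

/-- The players whose answers matter for a question. -/
def Question.Asked : Question k → Player k → Prop
  | consistency j, p => p = .alice ∨ p = .charlie j
  | game false _, p => p = .alice ∨ p = .bob
  | game true _, _ => True

/-- The product of the signs of the relevant answers in an accepting round. -/
def Question.targetSign : Question k → ℝ
  | game true b => bitSign b
  | _ => 1

/-- The nontrivial real character of `ZMod 2`. -/
def zmodSign (c : ZMod 2) : ℝ := if c = 0 then 1 else -1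

theorem zmodSign_add (a b : ZMod 2) : zmodSign (a + b) = zmodSign a * zmodSign b := by
  rcases zmod_two_eq_zero_or_one a with rfl | rfl <;>
    rcases zmod_two_eq_zero_or_one b with rfl | rfl <;>
    simp [zmodSign, CharTwo.add_self_eq_zero]

theorem zmodSign_sum {ι : Type*} (s : Finset ι) (f : ι → ZMod 2) :
    zmodSign (∑ i ∈ s, f i) = ∏ i ∈ s, zmodSign (f i) := by
  classical
  induction s using Finset.induction_on with
  | empty => simp [zmodSign]
  | insert i s hi ih => rw [Finset.sum_insert hi, Finset.prod_insert hi, zmodSign_add, ih]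

theorem zmodSign_ite (b : Bool) : zmodSign (if b then 1 else 0) = bitSign b := by
  cases b <;> simp [zmodSign, bitSign]

open Classical in
-- Every winning condition fixes the parity of the relevant answers, so winning probabilities reduce
-- to expectations of products of signs.
theorem Question.indicator_accept (Q : Question k) (x : Player k → Bool) :
    (if Q.Accept x then 1 else 0 : ℝ) =
      (1 + Q.targetSign * ∏ p, if Q.Asked p then bitSign (x p) else 1) / 2 := by
  rw [prod_player]
  match Q with
  | .consistency j =>
    cases h : x .alice <;> cases h' : x (.charlie j) <;>
      simp [Accept, targetSign, Asked, bitSign, h, h']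
  | .game false b =>
    cases h : x .alice <;> cases h' : x .bob <;>
      simp [Accept, targetSign, Asked, bitSign, h, h']
  | .game true b =>
    have key : ∀ c d : ZMod 2, (if c = d then 1 else 0 : ℝ) = (1 + zmodSign d * zmodSign c) / 2 := by
      intro c d
      rcases zmod_two_eq_zero_or_one c with rfl | rfl <;>
        rcases zmod_two_eq_zero_or_one d with rfl | rfl <;> simp [zmodSign]
    have hk := key ((if x .alice then 1 else 0) + (∑ j : Fin k, if x (.charlie j) then 1 else 0) +
      (if x .bob then 1 else 0)) (if b then 1 else 0)
    rw [zmodSign_add, zmodSign_add, zmodSign_sum] at hk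
    simp only [zmodSign_ite] at hk
    rw [if_congr (Iff.rfl : (game true b).Accept x ↔ (if x .alice then 1 else 0) +
      (∑ j : Fin k, if x (.charlie j) then 1 else 0) + (if x .bob then 1 else 0) =
        ((if b then 1 else 0) : ZMod 2)) rfl rfl]
    refine (Eq.trans (by congr) hk).trans ?_
    have ht : ∀ p : Player k, (game true b).Asked p := fun _ => trivial
    simp only [targetSign, if_pos (ht _)]
    ring

/-- The angles of the observables in the GHZ strategy. -/
noncomputable def ghzAngle : Player k → Option Bool → ℝ
  | .bob, some true => -(Real.pi / 4)
  | .bob, _ => Real.pi / 4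
  | _, some true => Real.pi / 2
  | _, _ => 0

/-- The local measurements on the GHZ state. -/
noncomputable def ghzMeasurements (k : ℕ) : LocalMeasurements (fun _ : Player k => 2) :=
  angleMeasurements ghzAngle

open Classical in
theorem sum_accept_ghz (Q : Question k) :
    ∑ x : Player k → Bool,
        (if Q.Accept x then quantumCorrelation (ghzState (Player k)) (ghzMeasurements k) Q.input x
          else 0) =
      1 / 2 + Q.targetSign / 4 * ∑ i, ∑ j, ∏ p,
        (if Q.Asked p then observable (ghzAngle p (Q.input p)) else 1) i j := by
  have : Nonempty (Player k) := ⟨.alice⟩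
  have h1 := sum_quantumCorrelation trace_ghzState (ghzMeasurements k) Q.input
  have h2 := sum_bitSign_mul_ghz ghzAngle Q.input Q.Asked
  have h3 : ∀ x : Player k → Bool,
      (if Q.Accept x then quantumCorrelation (ghzState (Player k)) (ghzMeasurements k) Q.input x
        else 0) =
      1 / 2 * quantumCorrelation (ghzState (Player k)) (ghzMeasurements k) Q.input x +
        Q.targetSign / 2 * ((∏ p, if Q.Asked p then bitSign (x p) else 1) *
          quantumCorrelation (ghzState (Player k)) (angleMeasurements ghzAngle) Q.input x) := by
    intro x
    rw [← ghzMeasurements, ← mul_one (quantumCorrelation _ _ _ _), ← mul_zero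
      (quantumCorrelation (ghzState (Player k)) (ghzMeasurements k) Q.input x), ← mul_ite,
      Q.indicator_accept]
    ring
  rw [Finset.sum_congr rfl fun x _ => h3 x, Finset.sum_add_distrib, ← Finset.mul_sum,
    ← Finset.mul_sum, h1, h2]
  ring

open Classical in
-- Both players measure `Z`: the off-diagonal terms vanish and each of the two diagonal terms is
-- `1`.
theorem sum_accept_ghz_consistency (j : Fin k) :
    ∑ x : Player k → Bool, (if (Question.consistency j).Accept x then
      quantumCorrelation (ghzState (Player k)) (ghzMeasurements k)
        (Question.consistency j).input x else 0) = 1 := by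
  rw [sum_accept_ghz]
  have hc : ∀ i, (Question.consistency j).Asked (Player.charlie i) ↔ i = j := fun i => by
    simp [Question.Asked]
  have ha : (Question.consistency j).Asked .alice := Or.inl rfl
  have hb : ¬ (Question.consistency j).Asked .bob := by simp [Question.Asked]
  have hi : (Question.consistency j).input (.charlie j) = some false := by simp [Question.input]
  have h : ∀ s : Fin 2, ∏ i : Fin k, (if (Question.consistency j).Asked (Player.charlie i) then
      observable (ghzAngle (.charlie i) ((Question.consistency j).input (.charlie i))) else 1) s s =
        observable 0 s s := by
    intro s
    rw [Finset.prod_eq_single j (fun i _ h => by rw [if_neg (mt (hc i).1 h), one_apply_eq])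
      (by simp), if_pos ((hc j).2 rfl), hi]
    rfl
  simp only [Fin.sum_univ_two, prod_player, if_pos ha, if_neg hb]
  rw [h 0, h 1]
  simp [Question.targetSign, Question.input, ghzAngle, observable]
  norm_num

open Classical in
-- For `A = 0` only diagonal terms survive and carry Bob's `cos (π / 4)`; for `A = 1` only
-- off-diagonal ones survive and carry `sin (± π / 4)`, whose sign is the target sign. Either way
-- the correlation is `√2 / 2`.
theorem sum_accept_ghz_game (a b : Bool) :
    ∑ x : Player k → Bool, (if (Question.game a b).Accept x then
      quantumCorrelation (ghzState (Player k)) (ghzMeasurements k)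
        (Question.game a b).input x else 0) = 1 - Real.sin (Real.pi / 8) ^ 2 := by
  have h8 : Real.sin (Real.pi / 8) ^ 2 = 1 / 2 - Real.sqrt 2 / 4 := by
    rw [Real.sin_sq_eq_half_sub, show 2 * (Real.pi / 8) = Real.pi / 4 by ring,
      Real.cos_pi_div_four]
    ring
  rw [sum_accept_ghz, h8]
  simp only [Fin.sum_univ_two, prod_player]
  cases a <;> cases b <;>
    simp [Question.targetSign, Question.Asked, Question.input, ghzAngle, observable, bitSign] <;>
    ring

theorem winProb_ghz (k : ℕ) :
    winProb k (quantumCorrelation (ghzState (Player k)) (ghzMeasurements k)) =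
      1 - (1 - consistencyProb k) * Real.sin (Real.pi / 8) ^ 2 := by
  rw [winProb, sum_question_prob_mul]
  simp only [sum_accept_ghz_consistency, sum_accept_ghz_game]
  have h' := consistencyProb_div_mul k
  simp
  linarith

theorem winProb_ghz_sub (k : ℕ) :
    1 - (1 - consistencyProb k) * Real.sin (Real.pi / 8) ^ 2 - (1 - 1 / (2 * (3 ^ k + 1))) =
      (Real.sqrt 2 - 1) / (2 * (3 ^ k + 1)) := by
  rw [one_sub_consistencyProb, Real.sin_sq_eq_half_sub, show 2 * (Real.pi / 8) = Real.pi / 4 by ring,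
    Real.cos_pi_div_four]
  field_simp
  ring

theorem winProb_ghz_le_quantumValue (k : ℕ) :
    winProb k (quantumCorrelation (ghzState (Player k)) (ghzMeasurements k)) ≤ quantumValue k :=
  have : Nonempty (Player k) := ⟨.alice⟩
  le_csSup (bddAbove_quantum_winProb k)
    ⟨_, _, ghzMeasurements k, posSemidef_ghzState, trace_ghzState, rfl⟩

end GHZGame

theorem theoremt (k : ℕ) :
    (∀ S : NSStrategy.{u} (Player k) (k + 1),
      winProb k S.correlation ≤ 1 - 1 / (2 * (3 ^ k + 1))) ∧
    1 - 1 / (2 * (3 ^ k + 1)) < quantumValue k ∧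
    (Real.sqrt 2 - 1) / (2 * (3 ^ k + 1)) ≤ quantumValue k - (1 - 1 / (2 * (3 ^ k + 1))) ∧
    ∃ E : LocalMeasurements (fun _ : Player k => 2),
      winProb k (quantumCorrelation (ghzState (Player k)) E) =
          1 - (1 - consistencyProb k) * Real.sin (Real.pi / 8) ^ 2 ∧
      (Real.sqrt 2 - 1) / (2 * (3 ^ k + 1)) ≤
        winProb k (quantumCorrelation (ghzState (Player k)) E)
          - (1 - 1 / (2 * (3 ^ k + 1))) := by
  have h1 := winProb_ghz_le_quantumValue k
  have h2 := winProb_ghz_sub k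
  have h3 : 0 < (Real.sqrt 2 - 1) / (2 * (3 ^ k + 1)) :=
    div_pos (sub_pos.2 Real.one_lt_sqrt_two) (by positivity)
  rw [← winProb_ghz] at h2
  exact ⟨fun S => S.winProb_le, by linarith, by linarith, ghzMeasurements k, winProb_ghz k, h2.ge⟩
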